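/- Let $P$ be a simple polygon in the plane with edge set $E$, let $\delta\colon E\to\mathbb{R}^+_0$ be an additive-weight function, and let $n_e$ denote the inward facing unit normal and $\overline{e}$ the supporting line of an edge $e$ of $P$. Let $\mathcal{W}_{P,\delta}(t)$, $t\ge 0$, be the additively-weighted wavefront of $(P,\delta)$: $\mathcal{W}_{P,\delta}(0)$ is the boundary of $P$, and at each time $\mathcal{W}_{P,\delta}(t)$ is the union of the boundaries of finitely many (possibly no) simple polygons with pairwise disjoint interiors and non-overlapping edges. Each edge of these polygons emanates from an edge $e$ of $P$, lies on the line $\overline{e}+\max(0,t-\delta(e))\cdot n_e$, and has its polygon on the side to which $n_e$ points. Between consecutive events (at a discrete set of times) incidences are preserved and the vertices move continuously. At an event the polygons are replaced by simple polygons that enclose the same area and whose edges continue old edges: edges that have shrunk to length zero are removed, polygons are split where a vertex has reached another part of the wavefront, the common portion of parallel edges that have moved into each other is removed, and collapsed polygons vanish. When adjacent edges have become collinear, they may be merged into one edge that continues either of them. Then the roof $$R(P,\delta) := \bigcup_{t\ge 0} \bigl(\mathcal{W}_{P,\delta}(t)\times\{t\}\bigr)\subset\mathbb{R}^2\times\mathbb{R}$$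 is weakly $z$-monotone, i.e., every line parallel to the $z$-axis intersects $R(P,\delta)$ in a connected (possibly empty) set. -/

import Mathlib

open Set Filter Topology
open scoped NNReal

noncomputable section

namespace StraightSkeleton

/-- The Euclidean plane. -/
abbrev Plane : Type := EuclideanSpace ℝ (Fin 2)

/-- A closed polygonal chain is simple if it has at least three vertices and its boundary is
traversed injectively: the half-open edges are nondegenerate and pairwise disjoint.
The edge with index `i` joins the vertex `i` to the cyclically next vertex `finRotate n i`. -/
def IsSimple {n : ℕ} (Q : Polygon Plane n) : Prop :=
  3 ≤ n ∧ Function.Injective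
    (fun q : Fin n × Ico (0 : ℝ) 1 => Q.edgePath ℝ q.1 (q.2 : ℝ))

/-- The interior of a polygon: the points off its boundary that lie in a bounded connected
component of the complement of the boundary. -/
def inside {n : ℕ} (Q : Polygon Plane n) : Set Plane :=
  {p | p ∉ Q.boundary ℝ ∧
    Bornology.IsBounded (connectedComponentIn (Q.boundary ℝ)ᶜ p)}

/-- `m` is the inward facing unit normal of the edge `i` of `Q`: it is a unit vector
perpendicular to the edge and, at every point in the relative interior of the edge, it points
into the interior of `Q`, whereas `-m` does not. -/
def IsInwardNormal {n : ℕ} (Q : Polygon Plane n) (i : Fin n) (m : Plane) : Prop :=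
  ‖m‖ = 1 ∧ inner ℝ m (Q (finRotate n i) - Q i) = 0 ∧
    ∀ x ∈ openSegment ℝ (Q i) (Q (finRotate n i)),
      ∀ᶠ s in 𝓝[>] (0 : ℝ), x + s • m ∈ inside Q ∧ x - s • m ∉ inside Q

/-- The inward facing unit normal `n_e` of the edge `e` (for a simple polygon there is exactly
one vector with the defining property). -/
def inwardNormal {N : ℕ} (P : Polygon Plane N) (e : Fin N) : Plane :=
  Classical.epsilon (IsInwardNormal P e)

/-- The line that carries the wavefront fragments of the edge `e` at time `t`: the supporting
line of `e`, translated by `max (0, t - δ e) • n_e`. -/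
def offsetLine {N : ℕ} (P : Polygon Plane N) (δ : Fin N → ℝ≥0) (e : Fin N) (t : ℝ) :
    Set Plane :=
  (fun x => x + max 0 (t - (δ e : ℝ)) • inwardNormal P e) ''
    (line[ℝ, P e, P (finRotate N e)] : Set Plane)

/-- A moving polygon each of whose edges is labelled with the edge of the input polygon (with
`N` edges) from which it emanates. -/
structure MovingPolygon (N : ℕ) where
  size : ℕ
  label : Fin size → Fin N
  position : ℝ → Polygon Plane size

/-- A finite (possibly empty) collection of labelled moving polygons: the wavefront polygons
between two consecutive events. -/
structure Phase (N : ℕ) where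
  count : ℕ
  polygon : Fin count → MovingPolygon N

namespace Phase

variable {N : ℕ}

/-- The point set formed by (the boundaries of) the polygons at time `t`. -/
def curve (F : Phase N) (t : ℝ) : Set Plane :=
  ⋃ j, ((F.polygon j).position t).boundary ℝ

/-- The points enclosed by the polygons at time `t`. -/
def region (F : Phase N) (t : ℝ) : Set Plane :=
  ⋃ j, inside ((F.polygon j).position t)

/-- `s` is, at time `t`, one of the segments emanated from the input edge `e`. -/
def IsFragment (F : Phase N) (t : ℝ) (e : Fin N) (s : Set Plane) : Prop :=
  ∃ j i, (F.polygon j).label i = e ∧ s = ((F.polygon j).position t).edgeSet ℝ i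

/-- The movement of the wavefront of `(P, δ)` during the time interval `[a, b)`, in which its
combinatorial structure does not change. The positions at time `b` are the limits for `t → b`;
there the polygons may be degenerate. -/
structure Propagates (P : Polygon Plane N) (δ : Fin N → ℝ≥0) (F : Phase N) (a b : ℝ) :
    Prop where
  /-- Vertices move continuously. -/
  continuousOn : ∀ j i, ContinuousOn (fun t => (F.polygon j).position t i) (Icc a b)
  /-- The wavefront polygons are simple. -/
  simple : ∀ j, ∀ t ∈ Ico a b, IsSimple ((F.polygon j).position t)
  /-- A fragment of `e` lies on the (stationary or moving) line prescribed for `e`. -/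
  on_line : ∀ j i, ∀ t ∈ Ico a b, ((F.polygon j).position t).edgeSet ℝ i ⊆
    offsetLine P δ ((F.polygon j).label i) t
  /-- A fragment of `e` has the wavefront polygon on the side to which `n_e` points. -/
  inward : ∀ j i, ∀ t ∈ Ico a b, IsInwardNormal ((F.polygon j).position t) i
    (inwardNormal P ((F.polygon j).label i))
  /-- Fragments of the same edge that are adjacent form one fragment. -/
  label_ne : ∀ j i, (F.polygon j).label (finRotate _ i) ≠ (F.polygon j).label i
  /-- A vertex with interior angle 180° moves perpendicularly to its incident edges. -/
  tangential : ∀ j i, inwardNormal P ((F.polygon j).label (finRotate _ i)) =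
      inwardNormal P ((F.polygon j).label i) →
    ∀ t ∈ Icc a b, ∃ c : ℝ, (F.polygon j).position t (finRotate _ i) =
      (F.polygon j).position a (finRotate _ i) + c • inwardNormal P ((F.polygon j).label i)
  /-- Different wavefront polygons have disjoint interiors ... -/
  disjoint : ∀ j k, j ≠ k → ∀ t ∈ Ico a b,
    Disjoint (inside ((F.polygon j).position t)) (inside ((F.polygon k).position t))
  /-- ... and their edges do not overlap. -/
  no_overlap : ∀ j k, j ≠ k → ∀ t ∈ Ico a b, ∀ i l,
    (((F.polygon j).position t).edgeSet ℝ i ∩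
      ((F.polygon k).position t).edgeSet ℝ l).Subsingleton

/-- The update of the wavefront at the event time `b`, from the old polygons (degenerate at
time `b`) to the new ones. The new polygons bound the same area as the old ones: off the limit
position of the old polygons, a point is enclosed by the new ones if and only if it was enclosed
by the old ones immediately before time `b`. Hence edges of length zero disappear, the common
portion of two parallel edges that have moved into each other disappears, a polygon is split
where one of its vertices has reached another part of it, and collapsed polygons are dropped.
Each new edge continues an old edge with the same label (if adjacent edges have become collinear,
a merged edge may continue either of them). -/
structure Event (F G : Phase N) (b : ℝ) : Prop where
  region_iff : ∀ p, p ∉ F.curve b → (p ∈ G.region b ↔ ∀ᶠ t in 𝓝[<] b, p ∈ F.region t)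
  inherits : ∀ e s, G.IsFragment b e s → ∃ s', F.IsFragment b e s' ∧ (s' ∩ s).Nontrivial

end Phase

/-- An additively-weighted wavefront propagation for the polygon `P` with additive weights `δ`:
an unbounded sequence of event times, starting at time zero, and the wavefront polygons between
consecutive events. Several events may take place at the same time. After the collapse of all
wavefront polygons, the phases are empty. -/
structure Wavefront {N : ℕ} (P : Polygon Plane N) (δ : Fin N → ℝ≥0) where
  time : ℕ → ℝ
  phase : ℕ → Phase N
  time_zero : time 0 = 0
  time_strictMono : StrictMono time
  time_tendsto : Tendsto time atTop atTop
  /-- At time zero the wavefront is `P`. -/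
  initial : (phase 0).curve 0 = P.boundary ℝ
  /-- At time zero, each fragment overlaps the edge of `P` from which it emanates. -/
  initial_label : ∀ e s, (phase 0).IsFragment 0 e s → (P.edgeSet ℝ e ∩ s).Nontrivial
  propagates : ∀ k, (phase k).Propagates P δ (time k) (time (k + 1))
  event : ∀ k, (phase k).Event (phase (k + 1)) (time (k + 1))

namespace Wavefront

variable {N : ℕ} {P : Polygon Plane N} {δ : Fin N → ℝ≥0}

/-- The wavefront at time `t`, as a point set. -/
def atTime (W : Wavefront P δ) (t : ℝ) : Set Plane :=
  ⋃ (k : ℕ) (_ : t ∈ Ico (W.time k) (W.time (k + 1))), (W.phase k).curve t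

/-- The roof: the union of the sets `W(t) × {t}` over all times `t ≥ 0`. -/
def roof (W : Wavefront P δ) : Set (Plane × ℝ) :=
  ⋃ t ∈ Ici (0 : ℝ), W.atTime t ×ˢ {t}

end Wavefront

/-- Weak `z`-monotonicity: every line parallel to the `z`-axis meets the set in a connected
(possibly empty) set. -/
def IsWeaklyZMonotone (R : Set (Plane × ℝ)) : Prop :=
  ∀ p : Plane, IsPreconnected (R ∩ {q | q.1 = p})

end StraightSkeleton

end

/-!
Let `C t` be the closure of the set of points enclosed by the wavefront polygons at time `t`. An
edge has its polygon on one side only and edges of different polygons do not overlap, so the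
wavefront at time `t` is the frontier of `C t`. If `C` is antitone, then `p` lies on the wavefront
exactly while `p ∈ C t` and `p ∉ interior (C t)`; the first condition persists backwards in time
and the second one forwards, so these times form an interval.

To see that `C` is antitone, it is enough to control a dense set of points, because the enclosed
set is open and `C t` is its closure. Between events the edges move inwards, hence a point
can only become enclosed when a vertex passes over it. The trace of a vertex has Hausdorff
dimension at most one: the vertex is at the same time on two lines whose positions are Lipschitz
functions of time; if these lines are parallel, then either the normals agree and the vertex moves
along the normal, or the normals are opposite and neither line can move. At an event the
enclosed set changes only on the limit position of the wavefront, again a set of dimension at most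
one. The complement of a set of dimension at most one is dense in the plane.
-/

namespace StraightSkeleton

section Dimension

variable {E : Type*} [NormedAddCommGroup E]

theorem dimH_segment_le_one [NormedSpace ℝ E] (x y : E) : dimH (segment ℝ x y) ≤ 1 := by
  rw [segment_eq_image_lineMap]
  exact ((lipschitzWith_lineMap x y).dimH_image_le _).trans
    ((dimH_mono (subset_univ _)).trans_eq Real.dimH_univ)

theorem dimH_le_finrank_of_sub_mem [NormedSpace ℝ E] [FiniteDimensional ℝ E]
    {K : Submodule ℝ E} {x₀ : E} {s : Set E} (h : ∀ x ∈ s, x - x₀ ∈ K) :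
    dimH s ≤ Module.finrank ℝ K :=
  calc
    dimH s ≤ dimH (AffineSubspace.mk' x₀ K : Set E) :=
      dimH_mono fun x hx => AffineSubspace.mem_mk'.2 (h x hx)
    _ = Module.finrank ℝ (vectorSpan ℝ (AffineSubspace.mk' x₀ K : Set E)) :=
      Real.Convex.dimH_eq_finrank_vectorSpan (AffineSubspace.convex _)
        ⟨x₀, AffineSubspace.self_mem_mk' _ _⟩
    _ = Module.finrank ℝ K := by
      rw [← direction_affineSpan, AffineSubspace.affineSpan_coe, AffineSubspace.direction_mk']

theorem closure_subset_closure_of_diff_subset [NormedSpace ℝ E] [FiniteDimensional ℝ E]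
    {U V S : Set E} (hU : IsOpen U) (hS : dimH S < Module.finrank ℝ E) (hUV : U \ S ⊆ V) :
    closure U ⊆ closure V :=
  closure_minimal (((dense_compl_of_dimH_lt_finrank hS).open_subset_closure_inter hU).trans
    (closure_mono hUV)) isClosed_closure

theorem dimH_image_le_one_of_lipschitzOnWith_inner [InnerProductSpace ℝ E]
    (hE : Module.finrank ℝ E = 2) {m m' : E} (hmm' : LinearIndependent ℝ ![m, m'])
    {w : ℝ → E} {s : Set ℝ} {C C' : ℝ≥0} (hw : LipschitzOnWith C (fun t => inner ℝ m (w t)) s)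
    (hw' : LipschitzOnWith C' (fun t => inner ℝ m' (w t)) s) : dimH (w '' s) ≤ 1 := by
  have : FiniteDimensional ℝ E := Module.finite_of_finrank_eq_succ hE
  let L : E →ₗ[ℝ] ℝ × ℝ := (innerₗ E m).prod (innerₗ E m')
  have hL : LinearMap.ker L = ⊥ := by
    refine LinearMap.ker_eq_bot'.2 fun x hx => ?_
    have hspan : Submodule.span ℝ (range ![m, m']) = ⊤ :=
      hmm'.span_eq_top_of_card_eq_finrank (by simp only [Fintype.card_fin, hE])
    refine ext_inner_left ℝ fun y => ?_
    rw [inner_zero_right]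
    have hy : y ∈ Submodule.span ℝ (range ![m, m']) := hspan ▸ Submodule.mem_top
    induction hy using Submodule.span_induction with
    | mem y hy =>
      obtain ⟨k, rfl⟩ := hy
      fin_cases k
      · exact congrArg Prod.fst hx
      · exact congrArg Prod.snd hx
    | zero => exact inner_zero_left x
    | add y z _ _ hy hz => rw [inner_add_left, hy, hz, add_zero]
    | smul c y _ hy => rw [real_inner_smul_left, hy, mul_zero]
  obtain ⟨K, -, hK⟩ := L.exists_antilipschitzWith hL
  calc
    dimH (w '' s) ≤ dimH (L '' (w '' s)) := hK.le_dimH_image _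
    _ = dimH ((fun t => (inner ℝ m (w t), inner ℝ m' (w t))) '' s) := by
      rw [image_image]; rfl
    _ ≤ dimH s := (hw.prodMk hw').dimH_image_le
    _ ≤ 1 := (dimH_mono (subset_univ s)).trans_eq Real.dimH_univ

theorem dimH_le_one_of_inner_eq [InnerProductSpace ℝ E] (hE : Module.finrank ℝ E = 2) {m : E}
    (hm : m ≠ 0) {c : ℝ} {s : Set E} (hs : ∀ x ∈ s, inner ℝ m x = c) : dimH s ≤ 1 := by
  have : FiniteDimensional ℝ E := Module.finite_of_finrank_eq_succ hE
  have : Fact (Module.finrank ℝ E = 1 + 1) := ⟨hE⟩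
  have hfinrank : Module.finrank ℝ (Submodule.span ℝ {m})ᗮ = 1 :=
    Submodule.finrank_orthogonal_span_singleton hm
  rcases s.eq_empty_or_nonempty with rfl | ⟨x₀, hx₀⟩
  · simp only [dimH_empty, zero_le]
  have hsub : ∀ x ∈ s, x - x₀ ∈ (Submodule.span ℝ {m})ᗮ := fun x hx => by
    rw [Submodule.mem_orthogonal_singleton_iff_inner_right, inner_sub_right, hs x hx, hs x₀ hx₀,
      sub_self]
  exact (dimH_le_finrank_of_sub_mem hsub).trans_eq (by rw [hfinrank, Nat.cast_one])

theorem eq_or_eq_neg_of_not_linearIndependent [NormedSpace ℝ E] {m m' : E}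
    (hnorm : ‖m‖ = ‖m'‖) (hli : ¬LinearIndependent ℝ ![m, m']) : m = m' ∨ m = -m' :=
  (sameRay_or_sameRay_neg_iff_not_linearIndependent.2 hli).imp (sameRay_iff_of_norm_eq hnorm).1
    (sameRay_iff_of_norm_eq (hnorm.trans (norm_neg m').symm)).1

end Dimension

section Topology

theorem dense_setOf_inner_ne {E : Type*} [NormedAddCommGroup E] [InnerProductSpace ℝ E] {m : E}
    (hm : m ≠ 0) (c : ℝ) : Dense {x : E | inner ℝ m x ≠ c} := by
  have hinner : innerSL ℝ m ≠ 0 := fun h =>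
    hm (inner_self_eq_zero.1 (DFunLike.congr_fun h m))
  exact (dense_compl_singleton c).preimage ((innerSL ℝ m).isOpenMap_of_ne_zero hinner)

theorem tendsto_add_smul_nhdsGT_zero {E : Type*} [AddCommGroup E] [Module ℝ E]
    [TopologicalSpace E] [ContinuousAdd E] [ContinuousSMul ℝ E] (x u : E) :
    Tendsto (fun s : ℝ => x + s • u) (𝓝[>] 0) (𝓝 x) := by
  have hcont : Continuous fun s : ℝ => x + s • u := by fun_prop
  simpa only [zero_smul, add_zero] using (hcont.tendsto 0).mono_left nhdsWithin_le_nhds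

theorem tendsto_sub_smul_nhdsGT_zero {E : Type*} [AddCommGroup E] [Module ℝ E]
    [TopologicalSpace E] [IsTopologicalAddGroup E] [ContinuousSMul ℝ E] (x u : E) :
    Tendsto (fun s : ℝ => x - s • u) (𝓝[>] 0) (𝓝 x) := by
  simpa only [smul_neg, sub_eq_add_neg] using tendsto_add_smul_nhdsGT_zero x (-u)

theorem mem_connectedComponentIn_of_mem_closure {X : Type*} [TopologicalSpace X]
    [LocallyConnectedSpace X] {U : Set X} (hU : IsOpen U) {x y : X} (hy : y ∈ U)
    (hyx : y ∈ closure (connectedComponentIn U x)) : y ∈ connectedComponentIn U x := by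
  obtain ⟨z, hzy, hzx⟩ :=
    mem_closure_iff.1 hyx _ hU.connectedComponentIn (mem_connectedComponentIn hy)
  rw [connectedComponentIn_eq hzx, ← connectedComponentIn_eq hzy]
  exact mem_connectedComponentIn hy

theorem exists_mem_openSegment_inter_notMem_finite {E : Type*} [AddCommGroup E] [Module ℝ E]
    [TopologicalSpace E] [IsTopologicalAddGroup E] [ContinuousSMul ℝ E]
    {x y p : E} (hxy : x ≠ y) (hp : p ∈ segment ℝ x y) {U F : Set E} (hU : IsOpen U)
    (hpU : p ∈ U) (hF : F.Finite) : ∃ z ∈ openSegment ℝ x y, z ∈ U ∧ z ∉ F := by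
  have hcont : Continuous (AffineMap.lineMap (k := ℝ) x y) := AffineMap.lineMap_continuous
  have hinj : Function.Injective (AffineMap.lineMap (k := ℝ) x y) :=
    AffineMap.lineMap_injective ℝ hxy
  rw [segment_eq_image_lineMap, ← closure_Ioo zero_ne_one] at hp
  obtain ⟨r, hr, rfl⟩ := hp
  obtain ⟨s, hsU, hs⟩ := mem_closure_iff.1 hr _ (hU.preimage hcont) hpU
  have hinf := infinite_of_mem_nhds s
    (((hU.preimage hcont).inter isOpen_Ioo).mem_nhds ⟨hsU, hs⟩)
  obtain ⟨_, ⟨q, ⟨hqU, hq⟩, rfl⟩, hqF⟩ := (hinf.image hinj.injOn).exists_notMem_finite hF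
  exact ⟨_, openSegment_eq_image_lineMap ℝ x y ▸ mem_image_of_mem _ hq, hqU, hqF⟩

theorem ordConnected_setOf_mem_frontier {X α : Type*} [TopologicalSpace X] [Preorder α]
    {C : α → Set X} {s : Set α} (hs : s.OrdConnected) (hC : AntitoneOn C s)
    (hclosed : ∀ t ∈ s, IsClosed (C t)) (x : X) :
    OrdConnected {t | t ∈ s ∧ x ∈ frontier (C t)} := by
  refine ⟨fun t₁ ⟨h₁, hx₁⟩ t₂ ⟨h₂, hx₂⟩ t ht => ?_⟩
  have hts : t ∈ s := hs.out h₁ h₂ ht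
  refine ⟨hts, subset_closure (hC hts h₂ ht.2 ((hclosed t₂ h₂).frontier_subset hx₂)), ?_⟩
  exact fun hint => hx₁.2 (interior_mono (hC h₁ hts ht.1) hint)

theorem biUnion_Ico_succ_eq {α X : Type*} [Preorder α] {f : ℕ → α} (hf : Monotone f)
    (S : ℕ → Set X) {k : ℕ} {t : α} (ht : t ∈ Ico (f k) (f (k + 1))) :
    ⋃ (j : ℕ) (_ : t ∈ Ico (f j) (f (j + 1))), S j = S k := by
  have hj : ∀ j, t ∈ Ico (f j) (f (j + 1)) → j = k := fun j hj => by_contra fun hne =>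
    disjoint_left.1 (hf.pairwise_disjoint_on_Ico_succ hne) hj ht
  exact Subset.antisymm (iUnion₂_subset fun j h => (hj j h ▸ subset_rfl))
    (subset_iUnion₂ (s := fun j (_ : t ∈ Ico (f j) (f (j + 1))) => S j) k ht)

end Topology

section Order

theorem antitoneOn_Ici_of_Icc_succ {α β : Type*} [LinearOrder α] [Preorder β] {f : ℕ → α}
    {C : α → β} (hf : Monotone f) (hlim : Tendsto f atTop atTop)
    (hC : ∀ k, AntitoneOn C (Icc (f k) (f (k + 1)))) : AntitoneOn C (Ici (f 0)) := by
  have hIcc : ∀ k, AntitoneOn C (Icc (f 0) (f k)) := by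
    intro k
    induction k with
    | zero => simp only [Icc_self, antitoneOn_singleton]
    | succ k ih =>
      have h₀ : f 0 ≤ f k := hf k.zero_le
      have h₁ : f k ≤ f (k + 1) := hf k.le_succ
      rw [← Icc_union_Icc_eq_Icc h₀ h₁]
      exact ih.union_right (hC k) (isGreatest_Icc h₀) (isLeast_Icc h₁)
  intro s hs t ht hst
  obtain ⟨k, hk⟩ := (hlim.eventually_ge_atTop t).exists
  exact hIcc k ⟨hs, hst.trans hk⟩ ⟨ht, hk⟩ hst

end Order

section Edges

variable {E : Type*} [NormedAddCommGroup E] [NormedSpace ℝ E] {n : ℕ}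

theorem edgeSet_eq_segment (Q : Polygon E n) (i : Fin n) :
    Q.edgeSet ℝ i = segment ℝ (Q i) (Q (finRotate n i)) :=
  affineSegment_eq_segment ℝ _ _

theorem openSegment_subset_edgeSet (Q : Polygon E n) (i : Fin n) :
    openSegment ℝ (Q i) (Q (finRotate n i)) ⊆ Q.edgeSet ℝ i :=
  (openSegment_subset_segment ℝ _ _).trans_eq (edgeSet_eq_segment Q i).symm

theorem left_mem_edgeSet (Q : Polygon E n) (i : Fin n) : Q i ∈ Q.edgeSet ℝ i :=
  left_mem_affineSegment ℝ _ _

theorem right_mem_edgeSet (Q : Polygon E n) (i : Fin n) : Q (finRotate n i) ∈ Q.edgeSet ℝ i :=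
  right_mem_affineSegment ℝ _ _

theorem isCompact_edgeSet (Q : Polygon E n) (i : Fin n) : IsCompact (Q.edgeSet ℝ i) := by
  rw [Polygon.edgeSet_eq_image_edgePath ℝ Q i]
  exact isCompact_Icc.image AffineMap.lineMap_continuous

theorem isClosed_boundary (Q : Polygon E n) : IsClosed (Q.boundary ℝ) :=
  (isCompact_iUnion fun i => isCompact_edgeSet Q i).isClosed

theorem edgeSet_subset_boundary (Q : Polygon E n) (i : Fin n) :
    Q.edgeSet ℝ i ⊆ Q.boundary ℝ := subset_iUnion (fun i => Q.edgeSet ℝ i) i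

theorem dimH_boundary_le_one (Q : Polygon E n) : dimH (Q.boundary ℝ) ≤ 1 := by
  simp only [Polygon.boundary, dimH_iUnion, iSup_le_iff, edgeSet_eq_segment]
  exact fun i => dimH_segment_le_one _ _

theorem exists_mem_openSegment_of_mem_boundary {Q : Polygon E n} {p : E}
    (hp : p ∈ Q.boundary ℝ) (hpQ : ∀ i, p ≠ Q i) :
    ∃ i, p ∈ openSegment ℝ (Q i) (Q (finRotate n i)) := by
  obtain ⟨i, hi⟩ := mem_iUnion.1 hp
  rw [edgeSet_eq_segment] at hi
  exact ⟨i, mem_openSegment_of_ne_left_right (hpQ i).symm (hpQ _).symm hi⟩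

variable {ι : Type*} {l : Filter ι} {v : ι → Polygon E n} {Q : Polygon E n}

theorem eventually_disjoint_edgeSet (hv : ∀ i, Tendsto (fun t => v t i) l (𝓝 (Q i)))
    {K : Set E} (hK : IsCompact K) {i : Fin n} (hd : Disjoint K (Q.edgeSet ℝ i)) :
    ∀ᶠ t in l, Disjoint K ((v t).edgeSet ℝ i) := by
  obtain ⟨ε, hε, hthick⟩ := hd.exists_thickenings hK (isCompact_edgeSet Q i).isClosed
  filter_upwards [Metric.tendsto_nhds.1 (hv i) ε hε,
    Metric.tendsto_nhds.1 (hv (finRotate n i)) ε hε] with t hleft hright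
  refine (hthick.mono_left (Metric.self_subset_thickening hε K)).mono_right ?_
  rw [edgeSet_eq_segment, edgeSet_eq_segment]
  refine ((convex_segment _ _).thickening ε).segment_subset ?_ ?_
  · exact Metric.mem_thickening_iff.2 ⟨_, left_mem_segment ℝ _ _, hleft⟩
  · exact Metric.mem_thickening_iff.2 ⟨_, right_mem_segment ℝ _ _, hright⟩

theorem eventually_disjoint_boundary (hv : ∀ i, Tendsto (fun t => v t i) l (𝓝 (Q i)))
    {K : Set E} (hK : IsCompact K) (hd : Disjoint K (Q.boundary ℝ)) :
    ∀ᶠ t in l, Disjoint K ((v t).boundary ℝ) := by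
  have hedges : ∀ᶠ t in l, ∀ i, Disjoint K ((v t).edgeSet ℝ i) :=
    eventually_all.2 fun i => eventually_disjoint_edgeSet hv hK
      (hd.mono_right (edgeSet_subset_boundary Q i))
  exact hedges.mono fun t ht => disjoint_iUnion_right.2 ht

end Edges

section Inside

variable {n : ℕ} {Q : Polygon Plane n}

theorem IsSimple.edge_ne (hQ : IsSimple Q) (i : Fin n) : Q i ≠ Q (finRotate n i) := by
  intro heq
  have hmidpoint := @hQ.2 (i, ⟨0, by simp⟩) (i, ⟨1 / 2, by norm_num⟩)
    (by simp only [Polygon.edgePath, ← heq, AffineMap.lineMap_same, AffineMap.const_apply])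
  have hparam : (0 : ℝ) = 1 / 2 := congrArg (fun q => (q.2 : ℝ)) hmidpoint
  norm_num at hparam

theorem IsSimple.notMem_edgeSet (hQ : IsSimple Q) {i j : Fin n} (hij : j ≠ i) {x : Plane}
    (hx : x ∈ openSegment ℝ (Q i) (Q (finRotate n i))) : x ∉ Q.edgeSet ℝ j := by
  rw [openSegment_eq_image_lineMap] at hx
  obtain ⟨s, hs, rfl⟩ := hx
  rw [Polygon.edgeSet_eq_image_edgePath]
  rintro ⟨r, hr, hrs⟩
  rcases hr.2.lt_or_eq with hr₁ | rfl
  · have hpair := @hQ.2 (j, ⟨r, hr.1, hr₁⟩) (i, ⟨s, hs.1.le, hs.2⟩) hrs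
    exact hij (congrArg Prod.fst hpair)
  · have hpair := @hQ.2 (finRotate n j, ⟨0, by simp⟩) (i, ⟨s, hs.1.le, hs.2⟩)
      (by simpa [Polygon.edgePath] using hrs)
    exact hs.1.ne (congrArg (fun q => (q.2 : ℝ)) hpair)

theorem IsSimple.vertex_notMem_openSegment (hQ : IsSimple Q) (i j : Fin n) :
    Q j ∉ openSegment ℝ (Q i) (Q (finRotate n i)) := by
  intro hj
  rcases eq_or_ne j i with rfl | hji
  · exact hQ.edge_ne j (left_mem_openSegment_iff.1 hj)
  · exact hQ.notMem_edgeSet hji hj (left_mem_edgeSet Q j)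

theorem mem_inside_iff_of_isPreconnected {p q : Plane} {s : Set Plane} (hs : IsPreconnected s)
    (hd : Disjoint s (Q.boundary ℝ)) (hp : p ∈ s) (hq : q ∈ s) : p ∈ inside Q ↔ q ∈ inside Q := by
  have hqp : q ∈ connectedComponentIn (Q.boundary ℝ)ᶜ p :=
    hs.subset_connectedComponentIn hp hd.subset_compl_right hq
  simp only [inside, mem_ofPred_eq, hd.notMem_of_mem_left hp, hd.notMem_of_mem_left hq,
    connectedComponentIn_eq hqp]

theorem isOpen_inside (Q : Polygon Plane n) : IsOpen (inside Q) := by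
  refine isOpen_iff_mem_nhds.2 fun p hp => ?_
  refine mem_of_superset ((isClosed_boundary Q).isOpen_compl.connectedComponentIn.mem_nhds
    (mem_connectedComponentIn hp.1)) fun q hq => ?_
  exact (mem_inside_iff_of_isPreconnected isPreconnected_connectedComponentIn
    (disjoint_left.2 (connectedComponentIn_subset _ _)) (mem_connectedComponentIn hp.1) hq).1 hp

theorem closure_inside_subset (Q : Polygon Plane n) :
    closure (inside Q) ⊆ inside Q ∪ Q.boundary ℝ := by
  refine fun p hp => or_iff_not_imp_right.2 fun hpQ => ?_
  obtain ⟨q, hqp, hq⟩ := mem_closure_iff.1 hp _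
    (isClosed_boundary Q).isOpen_compl.connectedComponentIn (mem_connectedComponentIn hpQ)
  exact (mem_inside_iff_of_isPreconnected isPreconnected_connectedComponentIn
    (disjoint_left.2 (connectedComponentIn_subset _ _)) (mem_connectedComponentIn hpQ) hqp).2 hq

namespace IsInwardNormal

variable {i : Fin n} {m : Plane}

theorem inner_self_eq_one (hm : IsInwardNormal Q i m) : inner ℝ m m = (1 : ℝ) := by
  rw [real_inner_self_eq_norm_sq, hm.1, one_pow]

theorem inner_add_smul (hm : IsInwardNormal Q i m) (x : Plane) (s : ℝ) :
    inner ℝ m (x + s • m) = inner ℝ m x + s := by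
  rw [inner_add_right, inner_smul_right, hm.inner_self_eq_one, mul_one]

theorem inner_sub_smul (hm : IsInwardNormal Q i m) (x : Plane) (s : ℝ) :
    inner ℝ m (x - s • m) = inner ℝ m x - s := by
  rw [inner_sub_right, inner_smul_right, hm.inner_self_eq_one, mul_one]

theorem inner_eq_of_mem_edgeSet (hm : IsInwardNormal Q i m) {x : Plane}
    (hx : x ∈ Q.edgeSet ℝ i) : inner ℝ m x = (inner ℝ m (Q i) : ℝ) := by
  rw [edgeSet_eq_segment, segment_eq_image'] at hx
  obtain ⟨s, -, rfl⟩ := hx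
  rw [inner_add_right, inner_smul_right, hm.2.1, mul_zero, add_zero]

theorem edgeSet_subset_closure_inside (hm : IsInwardNormal Q i m) :
    Q.edgeSet ℝ i ⊆ closure (inside Q) := by
  rw [edgeSet_eq_segment, ← closure_openSegment]
  refine closure_minimal (fun x hx => ?_) isClosed_closure
  exact mem_closure_of_tendsto (tendsto_add_smul_nhdsGT_zero x m)
    ((hm.2.2 x hx).mono fun _ hs => hs.1)

theorem eventually_sub_smul_notMem (hm : IsInwardNormal Q i m) (hQ : IsSimple Q) {x : Plane}
    (hx : x ∈ openSegment ℝ (Q i) (Q (finRotate n i))) :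
    ∀ᶠ s in 𝓝[>] (0 : ℝ), x - s • m ∉ closure (inside Q) := by
  have hlim : Tendsto (fun s : ℝ => x - s • m) (𝓝[>] 0) (𝓝 x) :=
    tendsto_sub_smul_nhdsGT_zero x m
  have hedges : ∀ᶠ s in 𝓝[>] (0 : ℝ), ∀ j, j ≠ i → x - s • m ∉ Q.edgeSet ℝ j :=
    eventually_all.2 fun j => eventually_imp_distrib_left.2 fun hji => hlim.eventually
      ((isCompact_edgeSet Q j).isClosed.isOpen_compl.mem_nhds (hQ.notMem_edgeSet hji hx))
  filter_upwards [hm.2.2 x hx, hedges, self_mem_nhdsWithin] with s hs hne hpos hcl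
  rcases closure_inside_subset Q hcl with hin | hbd
  · exact hs.2 hin
  obtain ⟨j, hj⟩ := mem_iUnion.1 hbd
  obtain rfl : j = i := by_contra fun hji => hne j hji hj
  have hinner : inner ℝ m (x - s • m) = (inner ℝ m x : ℝ) := by
    rw [hm.inner_eq_of_mem_edgeSet hj,
      hm.inner_eq_of_mem_edgeSet (openSegment_subset_edgeSet Q j hx)]
  rw [hm.inner_sub_smul, sub_eq_self] at hinner
  exact (mem_Ioi.1 hpos).ne' hinner

end IsInwardNormal

end Inside

section EdgeNeighborhood

variable {n : ℕ} {Q : Polygon Plane n} {i : Fin n} {B : Set Plane}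

/-- A convex open set that meets the relative interior of the edge `i` of `Q` and misses all
other edges. In such a set the line through the edge separates the inside of `Q` from the
outside. -/
structure IsEdgeNeighborhood (Q : Polygon Plane n) (i : Fin n) (B : Set Plane) : Prop where
  convex : Convex ℝ B
  isOpen : IsOpen B
  disjoint : ∀ j, j ≠ i → Disjoint B (Q.edgeSet ℝ j)
  nonempty : (B ∩ openSegment ℝ (Q i) (Q (finRotate n i))).Nonempty

namespace IsEdgeNeighborhood

theorem disjoint_boundary_of_inner_ne (hB : IsEdgeNeighborhood Q i B) {m : Plane}
    (hm : IsInwardNormal Q i m) {s : Set Plane}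
    (hs : ∀ x ∈ s, inner ℝ m x ≠ (inner ℝ m (Q i) : ℝ)) : Disjoint (B ∩ s) (Q.boundary ℝ) := by
  refine disjoint_iUnion_right.2 fun j => ?_
  rcases eq_or_ne j i with rfl | hji
  · exact disjoint_left.2 fun x hx hxj => hs x hx.2 (hm.inner_eq_of_mem_edgeSet hxj)
  · exact (hB.disjoint j hji).mono_left inter_subset_left

theorem mem_inside_of_inner_lt (hB : IsEdgeNeighborhood Q i B) {m y : Plane}
    (hm : IsInwardNormal Q i m) (hy : y ∈ B) (hlt : inner ℝ m (Q i) < (inner ℝ m y : ℝ)) :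
    y ∈ inside Q := by
  obtain ⟨x, hxB, hx⟩ := hB.nonempty
  obtain ⟨s, ⟨⟨hin, -⟩, hsB⟩, hs⟩ := (((hm.2.2 x hx).and
    ((tendsto_add_smul_nhdsGT_zero x m).eventually (hB.isOpen.mem_nhds hxB))).and
      self_mem_nhdsWithin).exists
  have hslt : inner ℝ m (Q i) < (inner ℝ m (x + s • m) : ℝ) := by
    rw [hm.inner_add_smul, hm.inner_eq_of_mem_edgeSet (openSegment_subset_edgeSet Q i hx)]
    exact lt_add_of_pos_right _ hs
  exact (mem_inside_iff_of_isPreconnected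
    (hB.convex.inter (convex_halfSpace_gt (innerₗ Plane m).isLinear _)).isPreconnected
    (hB.disjoint_boundary_of_inner_ne hm fun _ h => ne_of_gt h) ⟨hsB, hslt⟩ ⟨hy, hlt⟩).1 hin

theorem notMem_inside_of_inner_lt (hB : IsEdgeNeighborhood Q i B) {m y : Plane}
    (hm : IsInwardNormal Q i m) (hy : y ∈ B) (hlt : inner ℝ m y < (inner ℝ m (Q i) : ℝ)) :
    y ∉ inside Q := by
  obtain ⟨x, hxB, hx⟩ := hB.nonempty
  obtain ⟨s, ⟨⟨-, hout⟩, hsB⟩, hs⟩ := (((hm.2.2 x hx).and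
    ((tendsto_sub_smul_nhdsGT_zero x m).eventually (hB.isOpen.mem_nhds hxB))).and
      self_mem_nhdsWithin).exists
  have hslt : inner ℝ m (x - s • m) < (inner ℝ m (Q i) : ℝ) := by
    rw [hm.inner_sub_smul, hm.inner_eq_of_mem_edgeSet (openSegment_subset_edgeSet Q i hx)]
    exact sub_lt_self _ hs
  exact (mem_inside_iff_of_isPreconnected
    (hB.convex.inter (convex_halfSpace_lt (innerₗ Plane m).isLinear _)).isPreconnected
    (hB.disjoint_boundary_of_inner_ne hm fun _ h => ne_of_lt h) ⟨hsB, hslt⟩ ⟨hy, hlt⟩).not.1 hout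

theorem mem_inside_iff (hB : IsEdgeNeighborhood Q i B) {m y : Plane}
    (hm : IsInwardNormal Q i m) (hy : y ∈ B) :
    y ∈ inside Q ↔ inner ℝ m (Q i) < (inner ℝ m y : ℝ) := by
  refine ⟨fun hyin => not_le.1 fun hle => ?_, hB.mem_inside_of_inner_lt hm hy⟩
  -- `inside Q` is open, so a point on the line of the edge could be pushed strictly below it.
  have hopen : IsOpen (B ∩ inside Q) := hB.isOpen.inter (isOpen_inside Q)
  obtain ⟨s, ⟨hsB, hsin⟩, hs⟩ := (((tendsto_sub_smul_nhdsGT_zero y m).eventually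
    (hopen.mem_nhds ⟨hy, hyin⟩)).and self_mem_nhdsWithin).exists
  refine hB.notMem_inside_of_inner_lt hm hsB ?_ hsin
  rw [hm.inner_sub_smul]
  exact (sub_lt_self _ hs).trans_le hle

end IsEdgeNeighborhood

theorem exists_isEdgeNeighborhood_eventually {ι : Type*} {l : Filter ι}
    {v : ι → Polygon Plane n} (hv : ∀ i, Tendsto (fun t => v t i) l (𝓝 (Q i)))
    (hQ : IsSimple Q) {x : Plane} (hx : x ∈ openSegment ℝ (Q i) (Q (finRotate n i))) :
    ∃ B, x ∈ B ∧ IsEdgeNeighborhood Q i B ∧ ∀ᶠ t in l, IsEdgeNeighborhood (v t) i B := by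
  have hothers : IsClosed (⋃ j ∈ {j | j ≠ i}, Q.edgeSet ℝ j) :=
    (toFinite _).isClosed_biUnion fun j _ => (isCompact_edgeSet Q j).isClosed
  have hx_others : x ∉ ⋃ j ∈ {j | j ≠ i}, Q.edgeSet ℝ j := fun hx' =>
    have ⟨_, hj, hxj⟩ := mem_iUnion₂.1 hx'
    hQ.notMem_edgeSet hj hx hxj
  obtain ⟨r, hr, hrQ⟩ :=
    Metric.nhds_basis_closedBall.mem_iff.1 (hothers.isOpen_compl.mem_nhds hx_others)
  have hdisj : ∀ j, j ≠ i → Disjoint (Metric.closedBall x r) (Q.edgeSet ℝ j) := fun j hji =>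
    disjoint_left.2 fun y hy hyj => hrQ hy (mem_biUnion hji hyj)
  have hdisj_v : ∀ᶠ t in l, ∀ j, j ≠ i → Disjoint (Metric.closedBall x r) ((v t).edgeSet ℝ j) :=
    eventually_all.2 fun j => eventually_imp_distrib_left.2 fun hji =>
      eventually_disjoint_edgeSet hv (isCompact_closedBall x r) (hdisj j hji)
  have hmeets : ∀ᶠ t in l,
      (Metric.ball x r ∩ openSegment ℝ (v t i) (v t (finRotate n i))).Nonempty := by
    rw [openSegment_eq_image_lineMap] at hx
    obtain ⟨s, hs, rfl⟩ := hx
    have hlim : Tendsto (fun t => AffineMap.lineMap (v t i) (v t (finRotate n i)) s) l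
        (𝓝 (AffineMap.lineMap (Q i) (Q (finRotate n i)) s)) :=
      (hv i).lineMap (hv (finRotate n i)) tendsto_const_nhds
    filter_upwards [hlim.eventually (Metric.ball_mem_nhds _ hr)] with t ht
    exact ⟨_, ht, openSegment_eq_image_lineMap ℝ (v t i) _ ▸ mem_image_of_mem _ hs⟩
  refine ⟨Metric.ball x r, Metric.mem_ball_self hr,
    ⟨convex_ball x r, Metric.isOpen_ball,
      fun j hji => (hdisj j hji).mono_left Metric.ball_subset_closedBall,
      x, Metric.mem_ball_self hr, hx⟩, ?_⟩
  filter_upwards [hdisj_v, hmeets] with t ht hne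
  exact ⟨convex_ball x r, Metric.isOpen_ball,
    fun j hji => (ht j hji).mono_left Metric.ball_subset_closedBall, hne⟩

end EdgeNeighborhood

section Stability

variable {n : ℕ} {Q : Polygon Plane n}

theorem exists_mem_openSegment_mem_closure_connectedComponentIn (hQ : IsSimple Q) {p : Plane}
    (hp : p ∉ Q.boundary ℝ) : ∃ i, ∃ x ∈ openSegment ℝ (Q i) (Q (finRotate n i)),
      x ∈ closure (connectedComponentIn (Q.boundary ℝ)ᶜ p) := by
  by_contra! hno
  have hopen : IsOpen (Q.boundary ℝ)ᶜ := (isClosed_boundary Q).isOpen_compl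
  have hconn : IsConnected (range Q)ᶜ :=
    (finite_range Q).countable.isConnected_compl_of_one_lt_rank
      (Module.one_lt_rank_of_one_lt_finrank
        (by simp only [finrank_euclideanSpace_fin, Nat.one_lt_two]))
  have hvertex : ∀ i, Q i ∈ Q.boundary ℝ := fun i =>
    edgeSet_subset_boundary Q i (left_mem_edgeSet Q i)
  -- The component could only be left through an open edge, so it contains all non-vertices.
  have hsubset : (range Q)ᶜ ⊆ connectedComponentIn (Q.boundary ℝ)ᶜ p := by
    refine hconn.isPreconnected.subset_of_closure_inter_subset hopen.connectedComponentIn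
      ⟨p, ?_, mem_connectedComponentIn hp⟩ fun y ⟨hycl, hy⟩ => ?_
    · rintro ⟨i, rfl⟩
      exact hp (hvertex i)
    · refine mem_connectedComponentIn_of_mem_closure hopen (fun hyQ => ?_) hycl
      obtain ⟨i, hi⟩ := exists_mem_openSegment_of_mem_boundary hyQ fun i h => hy ⟨i, h.symm⟩
      exact hno i y hi hycl
  let i : Fin n := ⟨0, by have := hQ.1; lia⟩
  obtain ⟨x, hx⟩ : (openSegment ℝ (Q i) (Q (finRotate n i))).Nonempty :=
    ⟨_, midpoint_mem_openSegment _ _⟩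
  refine connectedComponentIn_subset _ _ (hsubset ?_)
    (edgeSet_subset_boundary Q i (openSegment_subset_edgeSet Q i hx))
  rintro ⟨j, rfl⟩
  exact hQ.vertex_notMem_openSegment i j hx

variable {ι : Type*} {l : Filter ι} {v : ι → Polygon Plane n} {m : Fin n → Plane}

theorem eventually_mem_inside_iff (hv : ∀ i, Tendsto (fun t => v t i) l (𝓝 (Q i)))
    (hQ : IsSimple Q) (hmQ : ∀ i, IsInwardNormal Q i (m i))
    (hm : ∀ i, ∀ᶠ t in l, IsInwardNormal (v t) i (m i)) {p : Plane} (hp : p ∉ Q.boundary ℝ) :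
    ∀ᶠ t in l, (p ∈ inside (v t) ↔ p ∈ inside Q) := by
  obtain ⟨i, x, hx, hxcl⟩ := exists_mem_openSegment_mem_closure_connectedComponentIn hQ hp
  obtain ⟨B, hxB, hB, hBv⟩ := exists_isEdgeNeighborhood_eventually hv hQ hx
  set C : Set Plane := connectedComponentIn (Q.boundary ℝ)ᶜ p
  have hC : IsOpen C := (isClosed_boundary Q).isOpen_compl.connectedComponentIn
  have hmi : m i ≠ 0 := norm_ne_zero_iff.1 (by rw [(hmQ i).1]; exact one_ne_zero)
  obtain ⟨y, ⟨hyB, hyC⟩, hyne⟩ :=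
    (dense_setOf_inner_ne hmi (inner ℝ (m i) (Q i))).inter_open_nonempty _
      (hB.isOpen.inter hC) (mem_closure_iff.1 hxcl B hB.isOpen hxB)
  obtain ⟨γ, hγ⟩ : JoinedIn C p y :=
    (hC.isConnected_iff_isPathConnected.1 (isConnected_connectedComponentIn_iff.2 hp)).joinedIn
      p (mem_connectedComponentIn hp) y hyC
  have hγQ : Disjoint (range γ) (Q.boundary ℝ) :=
    disjoint_left.2 (range_subset_iff.2 fun s => connectedComponentIn_subset _ _ (hγ s))
  have hmem : ∀ R : Polygon Plane n, Disjoint (range γ) (R.boundary ℝ) →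
      (p ∈ inside R ↔ y ∈ inside R) := fun R hR =>
    mem_inside_iff_of_isPreconnected (isPreconnected_range γ.continuous) hR γ.source_mem_range
      γ.target_mem_range
  have hlim : Tendsto (fun t => inner ℝ (m i) (v t i)) l (𝓝 (inner ℝ (m i) (Q i))) :=
    tendsto_const_nhds.inner (hv i)
  have hside : ∀ᶠ t in l, (inner ℝ (m i) (v t i) < (inner ℝ (m i) y : ℝ) ↔
      inner ℝ (m i) (Q i) < (inner ℝ (m i) y : ℝ)) := by
    rcases lt_or_gt_of_ne hyne with hlt | hgt
    · exact (hlim.eventually_const_lt hlt).mono fun t ht => iff_of_false ht.not_gt hlt.not_gt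
    · exact (hlim.eventually_lt_const hgt).mono fun t ht => iff_of_true ht hgt
  filter_upwards [eventually_disjoint_boundary hv (isCompact_range γ.continuous) hγQ, hBv, hm i,
    hside] with t hγt hBt hmt hst
  rw [hmem _ hγt, hmem _ hγQ, hBt.mem_inside_iff hmt hyB, hB.mem_inside_iff (hmQ i) hyB, hst]

end Stability

section Motion

variable {n : ℕ} {m : Fin n → Plane} {p : Plane}

theorem eventually_notMem_inside_of_inner_le {ι : Type*} {l : Filter ι}
    {v : ι → Polygon Plane n} {Q : Polygon Plane n}
    (hv : ∀ i, Tendsto (fun t => v t i) l (𝓝 (Q i))) (hQ : IsSimple Q)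
    (hmQ : ∀ i, IsInwardNormal Q i (m i)) (hm : ∀ i, ∀ᶠ t in l, IsInwardNormal (v t) i (m i))
    (hle : ∀ i, ∀ᶠ t in l, inner ℝ (m i) (Q i) ≤ (inner ℝ (m i) (v t i) : ℝ))
    (hpQ : ∀ i, p ≠ Q i) (hp : p ∉ inside Q) : ∀ᶠ t in l, p ∉ inside (v t) := by
  by_cases hpb : p ∈ Q.boundary ℝ
  · obtain ⟨i, hi⟩ := exists_mem_openSegment_of_mem_boundary hpb hpQ
    obtain ⟨B, hpB, -, hBv⟩ := exists_isEdgeNeighborhood_eventually hv hQ hi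
    filter_upwards [hBv, hm i, hle i] with t hBt hmt hlet
    rw [hBt.mem_inside_iff hmt hpB, not_lt,
      (hmQ i).inner_eq_of_mem_edgeSet (openSegment_subset_edgeSet Q i hi)]
    exact hlet
  · exact (eventually_mem_inside_iff hv hQ hmQ hm hpb).mono fun t ht => ht.not.2 hp

theorem notMem_inside_of_monotoneOn_inner {v : ℝ → Polygon Plane n} {a b : ℝ} (hab : a ≤ b)
    (hv : ∀ i, ContinuousOn (fun t => v t i) (Icc a b)) (hs : ∀ t ∈ Icc a b, IsSimple (v t))
    (hm : ∀ i, ∀ t ∈ Icc a b, IsInwardNormal (v t) i (m i))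
    (hmono : ∀ i, MonotoneOn (fun t => (inner ℝ (m i) (v t i) : ℝ)) (Icc a b))
    (hp : ∀ i, ∀ t ∈ Icc a b, p ≠ v t i) (hpa : p ∉ inside (v a)) : p ∉ inside (v b) := by
  have hm_ev : ∀ i t, ∀ᶠ t' in 𝓝[Icc a b] t, IsInwardNormal (v t') i (m i) := fun i t =>
    eventually_mem_nhdsWithin.mono (hm i)
  have hclosed : IsClosed ({t | p ∉ inside (v t)} ∩ Icc a b) := by
    refine isClosed_of_closure_subset fun t ht => ?_
    have htI : t ∈ Icc a b := closure_minimal inter_subset_right isClosed_Icc ht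
    refine ⟨fun hin => ?_, htI⟩
    have hstable := eventually_mem_inside_iff (fun i => hv i t htI) (hs t htI)
      (fun i => hm i t htI) (fun i => hm_ev i t) hin.1
    obtain ⟨t', ⟨hout, ht'⟩, hiff⟩ := ((mem_closure_iff_frequently.1 ht).and_eventually
      (eventually_nhdsWithin_iff.1 hstable)).exists
    exact hout ((hiff ht').2 hin)
  refine hclosed.Icc_subset_of_forall_mem_nhdsWithin hpa ?_ (right_mem_Icc.2 hab)
  rintro t ⟨hpt, htI⟩
  have htI' : t ∈ Icc a b := Ico_subset_Icc_self htI
  have hle : 𝓝[>] t ≤ 𝓝[Icc a b] t := by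
    rw [← nhdsWithin_Ioc_eq_nhdsGT htI.2]
    exact nhdsWithin_mono _ fun t' ht' => ⟨htI.1.trans ht'.1.le, ht'.2⟩
  refine eventually_notMem_inside_of_inner_le (fun i => (hv i t htI').mono_left hle)
    (hs t htI') (fun i => hm i t htI') (fun i => hle (hm_ev i t)) (fun i => ?_)
    (fun i => hp i t htI') hpt
  filter_upwards [hle eventually_mem_nhdsWithin, self_mem_nhdsWithin] with t' ht' hlt
  exact hmono i htI' ht' (le_of_lt hlt)

end Motion

section OffsetLine

variable {N n : ℕ} {P : Polygon Plane N} {δ : Fin N → ℝ≥0}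

/-- The signed distance of `offsetLine P δ e t` from the origin, measured along the inward normal
of `e`: the line consists of points `x` with `inner ℝ (inwardNormal P e) x = offsetValue P δ e t`
(see `inner_eq_offsetValue`). -/
noncomputable def offsetValue (P : Polygon Plane N) (δ : Fin N → ℝ≥0) (e : Fin N) (t : ℝ) : ℝ :=
  inner ℝ (inwardNormal P e) (P e) + max 0 (t - δ e)

theorem monotone_offsetValue (e : Fin N) : Monotone (offsetValue P δ e) := fun s t hst => by
  unfold offsetValue
  gcongr

theorem lipschitzWith_offsetValue (e : Fin N) : LipschitzWith 1 (offsetValue P δ e) := by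
  have hsub : LipschitzWith 1 fun t : ℝ => t - δ e :=
    LipschitzWith.of_dist_le_mul fun s t => by rw [dist_sub_right, NNReal.coe_one, one_mul]
  have hadd := (LipschitzWith.const (inner ℝ (inwardNormal P e) (P e) : ℝ)).add (hsub.const_max 0)
  rwa [zero_add] at hadd

theorem exists_eq_of_mem_offsetLine {e : Fin N} {t : ℝ} {x : Plane}
    (hx : x ∈ offsetLine P δ e t) : ∃ s : ℝ, x = P e + s • (P (finRotate N e) - P e) +
      max 0 (t - δ e) • inwardNormal P e := by
  obtain ⟨y, hy, rfl⟩ := hx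
  obtain ⟨s, rfl⟩ := mem_affineSpan_pair_iff_exists_lineMap_eq.1 hy
  exact ⟨s, by rw [AffineMap.lineMap_apply_module', add_comm (P e)]⟩

theorem inner_eq_zero_of_mem_offsetLine {e : Fin N} {t : ℝ} {x y m : Plane}
    (hxy : x ≠ y) (hx : x ∈ offsetLine P δ e t) (hy : y ∈ offsetLine P δ e t)
    (hm : inner ℝ m (y - x) = (0 : ℝ)) : inner ℝ m (P (finRotate N e) - P e) = (0 : ℝ) := by
  obtain ⟨r, rfl⟩ := exists_eq_of_mem_offsetLine hx
  obtain ⟨s, rfl⟩ := exists_eq_of_mem_offsetLine hy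
  rw [add_sub_add_right_eq_sub, add_sub_add_left_eq_sub, ← sub_smul, inner_smul_right] at hm
  refine (mul_eq_zero.1 hm).resolve_left fun hsr => hxy ?_
  rw [sub_eq_zero.1 hsr]

theorem inner_eq_offsetValue {Q : Polygon Plane n} (hQ : IsSimple Q) {i : Fin n} {e : Fin N}
    {t : ℝ} (hline : Q.edgeSet ℝ i ⊆ offsetLine P δ e t)
    (hm : IsInwardNormal Q i (inwardNormal P e)) {x : Plane} (hx : x ∈ Q.edgeSet ℝ i) :
    inner ℝ (inwardNormal P e) x = offsetValue P δ e t := by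
  have hperp : inner ℝ (inwardNormal P e) (P (finRotate N e) - P e) = (0 : ℝ) :=
    inner_eq_zero_of_mem_offsetLine (hQ.edge_ne i) (hline (left_mem_edgeSet Q i))
      (hline (right_mem_edgeSet Q i)) hm.2.1
  obtain ⟨s, rfl⟩ := exists_eq_of_mem_offsetLine (hline hx)
  rw [hm.inner_add_smul, inner_add_right, inner_smul_right, hperp, mul_zero, add_zero, offsetValue]

end OffsetLine

namespace Phase

variable {N : ℕ} {P : Polygon Plane N} {δ : Fin N → ℝ≥0} {F G : Phase N} {a b t : ℝ}

theorem isOpen_region (F : Phase N) (t : ℝ) : IsOpen (F.region t) :=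
  isOpen_iUnion fun _ => isOpen_inside _

theorem dimH_curve_le_one (F : Phase N) (t : ℝ) : dimH (F.curve t) ≤ 1 := by
  simp only [curve, dimH_iUnion, iSup_le_iff]
  exact fun j => dimH_boundary_le_one _

namespace Propagates

theorem inner_eq (h : F.Propagates P δ a b) (j i) (ht : t ∈ Ico a b) {x : Plane}
    (hx : x ∈ ((F.polygon j).position t).edgeSet ℝ i) :
    inner ℝ (inwardNormal P ((F.polygon j).label i)) x =
      offsetValue P δ ((F.polygon j).label i) t :=
  inner_eq_offsetValue (h.simple j t ht) (h.on_line j i t ht) (h.inward j i t ht) hx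

theorem dimH_trace_le_one (h : F.Propagates P δ a b) (j i) :
    dimH ((fun t => (F.polygon j).position t i) '' Ico a b) ≤ 1 := by
  rcases (Ico a b).eq_empty_or_nonempty with hab | ⟨t₀, ht₀⟩
  · simp only [hab, image_empty, dimH_empty, zero_le]
  have ha : a ∈ Ico a b := left_mem_Ico.2 (ht₀.1.trans_lt ht₀.2)
  obtain ⟨i, rfl⟩ := (finRotate _).surjective i
  set w : ℝ → Plane := fun t => (F.polygon j).position t (finRotate _ i)
  set e := (F.polygon j).label i
  set e' := (F.polygon j).label (finRotate _ i)
  set m := inwardNormal P e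
  set m' := inwardNormal P e'
  have hw : ∀ t ∈ Ico a b, inner ℝ m (w t) = offsetValue P δ e t := fun t ht =>
    h.inner_eq j i ht (right_mem_edgeSet _ i)
  have hw' : ∀ t ∈ Ico a b, inner ℝ m' (w t) = offsetValue P δ e' t := fun t ht =>
    h.inner_eq j _ ht (left_mem_edgeSet _ _)
  have hm : ‖m‖ = 1 := (h.inward j i a ha).1
  have hm' : ‖m'‖ = 1 := (h.inward j _ a ha).1
  have hm₀ : m ≠ 0 := norm_ne_zero_iff.1 (hm ▸ one_ne_zero)
  by_cases hli : LinearIndependent ℝ ![m, m']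
  · exact dimH_image_le_one_of_lipschitzOnWith_inner finrank_euclideanSpace_fin hli
      (fun s hs t ht => by simpa only [hw s hs, hw t ht] using lipschitzWith_offsetValue e s t)
      (fun s hs t ht => by simpa only [hw' s hs, hw' t ht] using lipschitzWith_offsetValue e' s t)
  rcases eq_or_eq_neg_of_not_linearIndependent (hm.trans hm'.symm) hli with hmm' | hmm'
  · have hmove : ∀ x ∈ w '' Ico a b, x - w a ∈ Submodule.span ℝ {m} := by
      rintro _ ⟨t, ht, rfl⟩
      obtain ⟨c, hc⟩ := h.tangential j i hmm'.symm t (Ico_subset_Icc_self ht)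
      exact Submodule.mem_span_singleton.2 ⟨c, (sub_eq_of_eq_add' hc).symm⟩
    exact (dimH_le_finrank_of_sub_mem hmove).trans_eq
      (by rw [finrank_span_singleton hm₀, Nat.cast_one])
  · refine dimH_le_one_of_inner_eq finrank_euclideanSpace_fin hm₀ (c := inner ℝ m (w a)) ?_
    rintro _ ⟨t, ht, rfl⟩
    have hneg : ∀ x, inner ℝ m x = -(inner ℝ m' x : ℝ) := fun x => by rw [hmm', inner_neg_left]
    refine le_antisymm ?_ ?_
    · rw [hneg, hneg, neg_le_neg_iff, hw' t ht, hw' a ha]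
      exact monotone_offsetValue e' ht.1
    · rw [hw t ht, hw a ha]
      exact monotone_offsetValue e ht.1

theorem antitoneOn_closure_region (h : F.Propagates P δ a b) :
    AntitoneOn (fun t => closure (F.region t)) (Ico a b) := by
  intro t₁ ht₁ t₂ ht₂ h₁₂
  have hI : Icc t₁ t₂ ⊆ Ico a b := fun t ht => ⟨ht₁.1.trans ht.1, ht.2.trans_lt ht₂.2⟩
  let traces : Set Plane := ⋃ j, ⋃ i, (fun t => (F.polygon j).position t i) '' Ico a b
  have htraces : dimH traces < Module.finrank ℝ Plane := by
    refine lt_of_le_of_lt (b := 1) ?_ ?_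
    · simp only [traces, dimH_iUnion, iSup_le_iff]
      exact h.dimH_trace_le_one
    · simp
  refine closure_subset_closure_of_diff_subset (F.isOpen_region t₂) htraces ?_
  rintro p ⟨hp, hp_traces⟩
  obtain ⟨j, hj⟩ := mem_iUnion.1 hp
  refine mem_iUnion.2 ⟨j, by_contra fun hout => ?_⟩
  refine notMem_inside_of_monotoneOn_inner h₁₂
    (fun i => (h.continuousOn j i).mono (hI.trans Ico_subset_Icc_self))
    (fun t ht => h.simple j t (hI ht)) (fun i t ht => h.inward j i t (hI ht))
    (fun i s hs t ht hst => ?_) (fun i t ht hpt => ?_) hout hj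
  · simp only [h.inner_eq j i (hI hs) (left_mem_edgeSet _ i),
      h.inner_eq j i (hI ht) (left_mem_edgeSet _ i)]
    exact monotone_offsetValue _ hst
  · exact hp_traces (mem_iUnion₂.2 ⟨j, i, t, hI ht, hpt.symm⟩)

theorem closure_region (h : F.Propagates P δ a b) (ht : t ∈ Ico a b) :
    closure (F.region t) = F.region t ∪ F.curve t := by
  refine Subset.antisymm ?_ (union_subset subset_closure ?_)
  · rw [region, closure_iUnion_of_finite, curve, ← iUnion_union_distrib]
    exact iUnion_mono fun j => closure_inside_subset _
  · refine iUnion_subset fun j => iUnion_subset fun i => ?_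
    exact (h.inward j i t ht).edgeSet_subset_closure_inside.trans
      (closure_mono (subset_iUnion (fun j => inside ((F.polygon j).position t)) j))

theorem finite_edgeSet_inter_boundary (h : F.Propagates P δ a b) (ht : t ∈ Ico a b) {j k}
    (hjk : j ≠ k) (i) : (((F.polygon j).position t).edgeSet ℝ i ∩
      ((F.polygon k).position t).boundary ℝ).Finite := by
  rw [Polygon.boundary, inter_iUnion]
  exact finite_iUnion fun l => (h.no_overlap j k hjk t ht i l).finite

theorem eventually_sub_smul_notMem_closure_region (h : F.Propagates P δ a b) (ht : t ∈ Ico a b)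
    {j i} {x : Plane} (hx : x ∈ openSegment ℝ ((F.polygon j).position t i)
      ((F.polygon j).position t (finRotate _ i)))
    (hxk : ∀ k, j ≠ k → x ∉ ((F.polygon k).position t).boundary ℝ) :
    ∀ᶠ s in 𝓝[>] (0 : ℝ),
      x - s • inwardNormal P ((F.polygon j).label i) ∉ closure (F.region t) := by
  have hm := h.inward j i t ht
  simp only [region, closure_iUnion_of_finite, mem_iUnion, not_exists, eventually_all]
  intro k
  rcases eq_or_ne j k with rfl | hjk
  · exact hm.eventually_sub_smul_notMem (h.simple j t ht) hx
  have hx_closure : x ∈ closure (inside ((F.polygon j).position t)) :=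
    hm.edgeSet_subset_closure_inside (openSegment_subset_edgeSet _ i hx)
  have hx_inside : x ∉ inside ((F.polygon k).position t) :=
    ((h.disjoint j k hjk t ht).closure_left (isOpen_inside _)).notMem_of_mem_left hx_closure
  have hxk_closure : x ∉ closure (inside ((F.polygon k).position t)) := fun hcl =>
    (closure_inside_subset _ hcl).elim hx_inside (hxk k hjk)
  exact (tendsto_sub_smul_nhdsGT_zero x _).eventually
    (isClosed_closure.isOpen_compl.mem_nhds hxk_closure)

theorem disjoint_interior_closure_region_curve (h : F.Propagates P δ a b) (ht : t ∈ Ico a b) :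
    Disjoint (interior (closure (F.region t))) (F.curve t) := by
  refine disjoint_left.2 fun p hp_interior hp => ?_
  obtain ⟨j, hj⟩ := mem_iUnion.1 hp
  obtain ⟨i, hi⟩ := mem_iUnion.1 hj
  have hfinite : (⋃ k ∈ {k | j ≠ k}, ((F.polygon j).position t).edgeSet ℝ i ∩
      ((F.polygon k).position t).boundary ℝ).Finite :=
    (toFinite _).biUnion fun k hk => h.finite_edgeSet_inter_boundary ht hk i
  rw [edgeSet_eq_segment] at hi
  obtain ⟨x, hx, hx_interior, hx_other⟩ := exists_mem_openSegment_inter_notMem_finite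
    ((h.simple j t ht).edge_ne i) hi isOpen_interior hp_interior hfinite
  have hxk : ∀ k, j ≠ k → x ∉ ((F.polygon k).position t).boundary ℝ := fun k hjk hxk =>
    hx_other (mem_biUnion (x := k) hjk ⟨openSegment_subset_edgeSet _ i hx, hxk⟩)
  obtain ⟨s, hs_out, hs_in⟩ := ((h.eventually_sub_smul_notMem_closure_region ht hx hxk).and
    ((tendsto_sub_smul_nhdsGT_zero x _).eventually (isOpen_interior.mem_nhds hx_interior))).exists
  exact hs_out (interior_subset hs_in)

theorem curve_eq_frontier (h : F.Propagates P δ a b) (ht : t ∈ Ico a b) :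
    F.curve t = frontier (closure (F.region t)) := by
  rw [isClosed_closure.frontier_eq]
  refine Subset.antisymm (fun p hp => ⟨?_, ?_⟩) fun p hp => ?_
  · exact h.closure_region ht ▸ Or.inr hp
  · exact (h.disjoint_interior_closure_region_curve ht).notMem_of_mem_right hp
  · exact (h.closure_region ht ▸ hp.1).resolve_left fun hreg =>
      hp.2 (interior_maximal subset_closure (F.isOpen_region t) hreg)

end Propagates

theorem Event.closure_region_subset (hE : F.Event G b) (h : F.Propagates P δ a b)
    (ht : t ∈ Ico a b) : closure (G.region b) ⊆ closure (F.region t) := by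
  suffices closure (G.region b) ⊆ closure (closure (F.region t)) from
    this.trans_eq closure_closure
  refine closure_subset_closure_of_diff_subset (S := F.curve b) (G.isOpen_region b)
    ((F.dimH_curve_le_one b).trans_lt (by simp)) ?_
  rintro p ⟨hp, hpc⟩
  obtain ⟨s, hs, hts, hsb⟩ := (((hE.region_iff p hpc).1 hp).and (Ioo_mem_nhdsLT ht.2)).exists
  exact h.antitoneOn_closure_region ht ⟨ht.1.trans hts.le, hsb⟩ hts.le (subset_closure hs)

end Phase

namespace Wavefront

variable {N : ℕ} {P : Polygon Plane N} {δ : Fin N → ℝ≥0} (W : Wavefront P δ)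

/-- The part of the plane that the wavefront has not yet left behind at time `t`: the closure of
the points enclosed by the wavefront polygons. -/
def closedRegion (t : ℝ) : Set Plane :=
  ⋃ (k : ℕ) (_ : t ∈ Ico (W.time k) (W.time (k + 1))), closure ((W.phase k).region t)

variable {W} {k : ℕ} {t : ℝ}

theorem closedRegion_eq (ht : t ∈ Ico (W.time k) (W.time (k + 1))) :
    W.closedRegion t = closure ((W.phase k).region t) :=
  biUnion_Ico_succ_eq W.time_strictMono.monotone _ ht

theorem atTime_eq (ht : t ∈ Ico (W.time k) (W.time (k + 1))) :
    W.atTime t = (W.phase k).curve t :=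
  biUnion_Ico_succ_eq W.time_strictMono.monotone _ ht

variable (W)

theorem exists_mem_Ico (ht : 0 ≤ t) : ∃ k, t ∈ Ico (W.time k) (W.time (k + 1)) := by
  have hcover : ⋃ k, Ico (W.time k) (W.time (k + 1)) = Ici (W.time 0) :=
    iUnion_Ico_map_succ_eq_Ici (fun k => W.time_strictMono.monotone k.zero_le)
      (not_bddAbove_of_tendsto_atTop W.time_tendsto)
  rw [← mem_iUnion, hcover, W.time_zero]
  exact ht

theorem isClosed_closedRegion (ht : 0 ≤ t) : IsClosed (W.closedRegion t) := by
  obtain ⟨k, hk⟩ := W.exists_mem_Ico ht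
  exact closedRegion_eq hk ▸ isClosed_closure

theorem atTime_eq_frontier_closedRegion (ht : 0 ≤ t) :
    W.atTime t = frontier (W.closedRegion t) := by
  obtain ⟨k, hk⟩ := W.exists_mem_Ico ht
  rw [atTime_eq hk, closedRegion_eq hk, (W.propagates k).curve_eq_frontier hk]

theorem antitoneOn_closedRegion_Icc (k : ℕ) :
    AntitoneOn W.closedRegion (Icc (W.time k) (W.time (k + 1))) := by
  intro t₁ ht₁ t₂ ht₂ h₁₂
  rcases h₁₂.eq_or_lt with rfl | hlt
  · exact subset_rfl
  have ht₁' : t₁ ∈ Ico (W.time k) (W.time (k + 1)) := ⟨ht₁.1, hlt.trans_le ht₂.2⟩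
  rw [closedRegion_eq ht₁']
  rcases ht₂.2.eq_or_lt with rfl | ht₂'
  · rw [closedRegion_eq (left_mem_Ico.2 (W.time_strictMono (k + 1).lt_succ_self))]
    exact (W.event k).closure_region_subset (W.propagates k) ht₁'
  · rw [closedRegion_eq ⟨ht₂.1, ht₂'⟩]
    exact (W.propagates k).antitoneOn_closure_region ht₁' ⟨ht₂.1, ht₂'⟩ h₁₂

theorem antitoneOn_closedRegion : AntitoneOn W.closedRegion (Ici 0) :=
  W.time_zero ▸ antitoneOn_Ici_of_Icc_succ W.time_strictMono.monotone W.time_tendsto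
    W.antitoneOn_closedRegion_Icc

theorem ordConnected_setOf_mem_atTime (p : Plane) :
    OrdConnected {t | t ∈ Ici 0 ∧ p ∈ W.atTime t} := by
  have hfrontier : {t | t ∈ Ici 0 ∧ p ∈ W.atTime t} =
      {t | t ∈ Ici 0 ∧ p ∈ frontier (W.closedRegion t)} :=
    Set.ext fun t => and_congr_right fun ht => by rw [W.atTime_eq_frontier_closedRegion ht]
  rw [hfrontier]
  exact ordConnected_setOf_mem_frontier ordConnected_Ici W.antitoneOn_closedRegion
    (fun t ht => W.isClosed_closedRegion ht) p

theorem roof_inter_vertical_line (p : Plane) :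
    W.roof ∩ {q | q.1 = p} = Prod.mk p '' {t | t ∈ Ici 0 ∧ p ∈ W.atTime t} := by
  ext ⟨q, t⟩
  simp only [roof, mem_inter_iff, mem_iUnion, mem_prod, mem_singleton_iff, mem_ofPred_eq,
    mem_image, Prod.mk.injEq]
  constructor
  · rintro ⟨⟨s, hs, hq, rfl⟩, rfl⟩
    exact ⟨t, ⟨hs, hq⟩, rfl, rfl⟩
  · rintro ⟨s, ⟨hs, hp⟩, rfl, rfl⟩
    exact ⟨⟨s, hs, hp, rfl⟩, rfl⟩

end Wavefront

end StraightSkeleton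

theorem mainTheorem5_general {N : ℕ} {P : Polygon StraightSkeleton.Plane N} {δ : Fin N → ℝ≥0}
    (W : StraightSkeleton.Wavefront P δ) : StraightSkeleton.IsWeaklyZMonotone W.roof := by
  intro p
  rw [W.roof_inter_vertical_line]
  exact (W.ordConnected_setOf_mem_atTime p).isPreconnected.image _ (by fun_prop)

theorem mainTheorem5 {N : ℕ} (P : Polygon StraightSkeleton.Plane N)
    (hP : StraightSkeleton.IsSimple P) (δ : Fin N → ℝ≥0)
    (W : StraightSkeleton.Wavefront P δ) :
    StraightSkeleton.IsWeaklyZMonotone W.roof :=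
  mainTheorem5_general W
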